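/- Conventions. For a family $\mathcal F$ of subsets of $\mathbb N=\{0,1,2,\dots\}$ and $f,g\in\mathbb N^{\mathbb N}$ write $f\le_{\mathcal F}g$ if $\{n: f(n)\le g(n)\}\in\mathcal F$; a set $Y\subseteq\mathbb N^{\mathbb N}$ is bounded with respect to $\le_{\mathcal F}$ if there is $g\in\mathbb N^{\mathbb N}$ with $f\le_{\mathcal F}g$ for all $f\in Y$. Let $\mathfrak b(\mathcal F)$ be the least cardinality of a subset of $\mathbb N^{\mathbb N}$ that is unbounded with respect to $\le_{\mathcal F}$, and let $\mathcal F^+=\{A\subseteq\mathbb N: \mathbb N\setminus A\notin\mathcal F\}$. A space $Y$ satisfies $\mathrm{Bdd}(\mathcal F)$ if every continuous image of $Y$ in the Baire space $\mathbb N^{\mathbb N}$ is bounded with respect to $\le_{\mathcal F}$; it has the Hurewicz property if for every continuous image of $Y$ in $\mathbb N^{\mathbb N}$ there is a single $g\in\mathbb N^{\mathbb N}$ such that each $f$ in the image satisfies $f(n)\le g(n)$ for all but finitely many $n$. Filters on $\mathbb N$ are proper and free, i.e. they contain all cofinite sets and all their members are infinite. A filter $\mathcal F$ is feeble if there is a strictly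 increasing $h\in\mathbb N^{\mathbb N}$ such that each $A\in\mathcal F$ meets $[h(n),h(n+1))$ for all but finitely many $n$. A $\mathfrak b(\mathcal F)$-scale is a set $S=\{f_\alpha:\alpha<\mathfrak b(\mathcal F)\}$ of strictly increasing elements of $\mathbb N^{\mathbb N}$ that is unbounded with respect to $\le_{\mathcal F}$ and satisfies $f_\alpha\le_{\mathcal F}f_\beta$ for all $\alpha<\beta<\mathfrak b(\mathcal F)$. Let $\mathrm{Inc}$ be the subspace of $(\mathbb N\cup\{\infty\})^{\mathbb N}$ (product of copies of the one-point compactification of the discrete space $\mathbb N$) consisting of all nondecreasing $x$ with $x(n)<x(n+1)$ whenever $x(n)<\infty$; it is homeomorphic to the Cantor space. Let $Q\subseteq\mathrm{Inc}$ be the countable set of all sequences that consist of a finite strictly increasing sequence of natural numbers followed by the constant value $\infty$. Every strictly increasing element of $\mathbb N^{\mathbb N}$ is regarded as an element of $\mathrm{Inc}$. **Theorem.** Let $C\subseteq\mathbb R$ be algebraically independent over $\mathbb Q$ and homeomorphic to $\mathrm{Inc}$, and identify $\mathrm{Inc}$ with $C$ by a homeomorphism. Let $\mathcal F$ be a filter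 on $\mathbb N$, let $S$ be a $\mathfrak b(\mathcal F)$-scale, let $X=S\cup Q\subseteq C\subseteq\mathbb R$, and let $\mathbb Q(X)$ be the subfield of $\mathbb R$ generated by $\mathbb Q\cup X$, with the subspace topology. Then: 1. All finite powers $\mathbb Q(X)^k$ satisfy $\mathrm{Bdd}(\mathcal F^+)$. 2. If $\mathcal F$ is an ultrafilter, then all finite powers $\mathbb Q(X)^k$ satisfy $\mathrm{Bdd}(\mathcal F)$. 3. If $\mathcal F$ is feeble, then all finite powers $\mathbb Q(X)^k$ have the Hurewicz property. 4. For each property $P$ of sets of reals that is hereditary for (relatively) closed subsets, if $X$ does not have the property $P$, then $\mathbb Q(X)$ does not have the property $P$. 5. $\mathbb Q(X)$ is not $\sigma$-compact. -/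

import Mathlib

namespace ScaleField

/-- The relation `f ≤_𝓕 g`: the set `[f ≤ g] = {n | f n ≤ g n}` belongs to the family `𝓕`. -/
def LeMod (𝓕 : Set (Set ℕ)) (f g : ℕ → ℕ) : Prop :=
  {n | f n ≤ g n} ∈ 𝓕

/-- `Y ⊆ ℕ^ℕ` is bounded with respect to `≤_𝓕`. -/
def BoundedMod (𝓕 : Set (Set ℕ)) (Y : Set (ℕ → ℕ)) : Prop :=
  ∃ g : ℕ → ℕ, ∀ f ∈ Y, LeMod 𝓕 f g

/-- `𝓕⁺`, the family of all sets whose complement is not in `𝓕`. -/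
def positive (𝓕 : Set (Set ℕ)) : Set (Set ℕ) :=
  {A | Aᶜ ∉ 𝓕}

/-- The property `Bdd(𝓕)` of a space: every continuous image in the Baire space is bounded with
respect to `≤_𝓕`. -/
def Bdd (𝓕 : Set (Set ℕ)) (X : Type*) [TopologicalSpace X] : Prop :=
  ∀ Ψ : X → (ℕ → ℕ), Continuous Ψ → BoundedMod 𝓕 (Set.range Ψ)

/-- The Hurewicz property: every continuous image in the Baire space is bounded with respect to
`≤*` (inequality at all but finitely many places). -/
def Hurewicz (X : Type*) [TopologicalSpace X] : Prop :=
  ∀ Ψ : X → (ℕ → ℕ), Continuous Ψ →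
    ∃ g : ℕ → ℕ, ∀ f ∈ Set.range Ψ, ∀ᶠ n in Filter.atTop, f n ≤ g n

/-- `𝓕` is feeble: for some increasing `h`, every member of `𝓕` meets all but finitely many of the
intervals `[h n, h (n + 1))`. -/
def Feeble (𝓕 : Set (Set ℕ)) : Prop :=
  ∃ h : ℕ → ℕ, StrictMono h ∧
    ∀ A ∈ 𝓕, ∀ᶠ n in Filter.atTop, (A ∩ Set.Ico (h n) (h (n + 1))).Nonempty

/-- The cardinal `𝔟(𝓕)`: the least cardinality of a subset of `ℕ^ℕ` that is unbounded with respect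
to `≤_𝓕`. -/
noncomputable def bNum (𝓕 : Set (Set ℕ)) : Cardinal.{0} :=
  sInf {κ | ∃ Y : Set (ℕ → ℕ), ¬ BoundedMod 𝓕 Y ∧ Cardinal.mk Y = κ}

/-- `S = {f α : α < 𝔟(𝓕)}` is a `𝔟(𝓕)`-scale: a family of increasing functions that is unbounded
with respect to `≤_𝓕`, enumerated so that `f α ≤_𝓕 f β` for `α < β < 𝔟(𝓕)`. -/
def IsScale (𝓕 : Set (Set ℕ)) (S : Set (ℕ → ℕ)) : Prop :=
  (∀ u ∈ S, StrictMono u) ∧ ¬ BoundedMod 𝓕 S ∧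
    ∃ f : Ordinal.{0} → (ℕ → ℕ),
      S = f '' Set.Iio (bNum 𝓕).ord ∧
      ∀ α β : Ordinal.{0}, α < β → β < (bNum 𝓕).ord → LeMod 𝓕 (f α) (f β)

/-- The space of all nondecreasing `x : ℕ → ℕ ∪ {∞}` with `x n < x (n + 1)` whenever `x n < ∞`, as a
subspace of the product. The order topology of `ℕ∞` is that of the one-point compactification
of the discrete space `ℕ`. -/
abbrev Inc : Type :=
  {x : ℕ → ℕ∞ // Monotone x ∧ ∀ n, x n < ⊤ → x n < x (n + 1)}

/-- The sequence `q_s`, which is the finite sequence `s` followed by the constant value `∞`. -/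
def qSeq (s : List ℕ) (n : ℕ) : ℕ∞ :=
  if h : n < s.length then ((s[n]'h : ℕ) : ℕ∞) else ⊤

/-- The countable dense set `Q ⊆ Inc` of all `q_s`, for `s` a finite increasing sequence. -/
def Q : Set Inc :=
  {x | ∃ s : List ℕ, s.Pairwise (· < ·) ∧ x.1 = qSeq s}

/-- A set of increasing functions `ℕ → ℕ`, regarded as a subset of `Inc`. -/
def toInc (S : Set (ℕ → ℕ)) : Set Inc :=
  {x | ∃ f ∈ S, x.1 = fun n => (f n : ℕ∞)}

/-- The copy in `C ⊆ ℝ` of a set `X ⊆ Inc`, under an identification of `Inc` with `C`. -/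
def realCopy {C : Set ℝ} (e : Inc ≃ₜ C) (X : Set Inc) : Set ℝ :=
  (fun x : Inc => (e x : ℝ)) '' X

/-- A property of sets of reals that passes to relatively closed subsets. -/
def ClosedHereditary (P : Set ℝ → Prop) : Prop :=
  ∀ A Z : Set ℝ, IsClosed Z → P A → P (A ∩ Z)

end ScaleField

open ScaleField

namespace ScaleField

open Filter Set

/-! ### The space `Inc` -/

/-! Write `T` for `S ∪ Q`. Compactness of `Inc` shows that a continuous map on `T^n` is bounded at
each place once all coordinates are large there, since a point with value `∞` lies in `Q`. This
gives a `g`; choose `u ∈ S` with `u ≰_F g`. All but fewer than `𝔟(F)` points of `T` lie `F`-above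
`u`, and tuples of such points are bounded on an `F`-positive set. The other tuples have a
coordinate in a small set: fix it, induct on `n`, and merge fewer than `𝔟(F)` bounds. For feeble
`F`, monotonicity spreads these estimates over intervals and yields `≤*`.

Powers of `ℚ(X)` are covered by countably many images of clopen pieces of powers of `T` under
rational maps; algebraic independence keeps denominators nonzero at injective tuples. Finally `ℚ(X)
∩ C = X` with `C` compact, so closed-hereditary properties and σ-compactness pass down to `X`, and a
σ-compact `T` would make `S` countable. -/

theorem isClosed_inc :
    IsClosed {x : ℕ → ℕ∞ | Monotone x ∧ ∀ n, x n < ⊤ → x n < x (n + 1)} := by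
  have h : {x : ℕ → ℕ∞ | Monotone x ∧ ∀ n, x n < ⊤ → x n < x (n + 1)} =
      ⋂ n, {x : ℕ → ℕ∞ | x n + 1 ≤ x (n + 1)} := by
    ext x
    simp only [mem_ofPred_eq, mem_iInter]
    constructor
    · rintro ⟨hm, h⟩ n
      rcases eq_or_ne (x n) ⊤ with hn | hn
      · have := hm (Nat.le_succ n)
        rw [hn, top_le_iff] at this
        simp [this]
      · exact Order.add_one_le_of_lt (h n hn.lt_top)
    · intro h
      refine ⟨monotone_nat_of_le_succ fun n => le_self_add.trans (h n), fun n hn => ?_⟩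
      exact (ENat.add_one_le_iff hn.ne).1 (h n)
  rw [h]
  exact isClosed_iInter fun n =>
    isClosed_le ((continuous_apply n).add continuous_const) (continuous_apply (n + 1))

instance compactSpace_inc : CompactSpace Inc :=
  isCompact_iff_compactSpace.1 isClosed_inc.isCompact

theorem continuous_inc_apply (n : ℕ) : Continuous fun x : Inc => x.1 n :=
  (continuous_apply n).comp continuous_subtype_val

theorem qSeq_of_length_le (s : List ℕ) {m : ℕ} (h : s.length ≤ m) : qSeq s m = ⊤ := by
  simp [qSeq, not_lt.2 h]

theorem mem_Q_of_apply_eq_top (x : Inc) {n : ℕ} (hn : x.1 n = ⊤) : x ∈ Q := by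
  classical
  have hex : ∃ n, x.1 n = ⊤ := ⟨n, hn⟩
  set N := Nat.find hex with hN
  have hlt : ∀ m < N, x.1 m ≠ ⊤ := fun m hm => Nat.find_min hex hm
  have hge : ∀ m, N ≤ m → x.1 m = ⊤ := fun m hm =>
    top_le_iff.1 ((Nat.find_spec hex).ge.trans (x.2.1 hm))
  have hsm : ∀ i j, i < j → j < N → x.1 i < x.1 j := fun i j hij hj =>
    (x.2.2 i (hlt i (hij.trans hj)).lt_top).trans_le (x.2.1 hij)
  refine ⟨List.ofFn fun i : Fin N => (x.1 i).toNat, ?_, ?_⟩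
  · rw [List.pairwise_ofFn]
    intro i j hij
    have h := hsm i j hij j.2
    rw [← ENat.natCast_toNat (hlt i i.2), ← ENat.natCast_toNat (hlt j j.2)] at h
    exact_mod_cast h
  · funext m
    by_cases hm : m < N
    · simp [qSeq, hm, ENat.natCast_toNat (hlt m hm)]
    · simp [qSeq, hm, hge m (not_lt.1 hm)]

theorem eventually_eq_top_of_mem_Q {x : Inc} (hx : x ∈ Q) : ∀ᶠ m in atTop, x.1 m = ⊤ := by
  obtain ⟨s, -, hs⟩ := hx
  filter_upwards [eventually_ge_atTop s.length] with m hm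
  rw [hs, qSeq_of_length_le s hm]

/-- A strictly increasing sequence of natural numbers, as an element of `Inc`. -/
def incOf (f : {f : ℕ → ℕ // StrictMono f}) : Inc :=
  ⟨fun n => (f.1 n : ℕ∞), fun _ _ h => Nat.cast_le.2 (f.2.monotone h),
    fun n _ => Nat.cast_lt.2 (f.2 n.lt_succ_self)⟩

theorem continuous_incOf : Continuous incOf := by
  refine Continuous.subtype_mk (continuous_pi fun n => ?_) _
  exact (continuous_of_discreteTopology (f := fun k : ℕ => (k : ℕ∞))).comp
    ((continuous_apply n).comp continuous_subtype_val)

theorem incOf_notMem_Q (f : {f : ℕ → ℕ // StrictMono f}) : incOf f ∉ Q := fun h => by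
  obtain ⟨m, hm⟩ := (eventually_eq_top_of_mem_Q h).exists
  exact ENat.natCast_ne_top _ hm

theorem incOf_mem_toInc {S : Set (ℕ → ℕ)} {f : {f : ℕ → ℕ // StrictMono f}} :
    incOf f ∈ toInc S ↔ f.1 ∈ S := by
  constructor
  · rintro ⟨g, hg, h⟩
    have : f.1 = g := by
      funext n
      exact Nat.cast_injective (R := ℕ∞) (congrFun h n)
    rwa [this]
  · exact fun h => ⟨f.1, h, rfl⟩

/-- A continuous map from a power of a set containing `Q` to the Baire space is bounded, at each
place, on the points all of whose coordinates are large at that place. -/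
theorem exists_bound_of_large {T : Set Inc} (hT : Q ⊆ T) {ι : Type*} [Finite ι]
    {Ψ : (ι → T) → ℕ → ℕ} (hΨ : Continuous Ψ) :
    ∃ g : ℕ → ℕ, ∀ x m, (∀ i, (g m : ℕ∞) ≤ (x i).1.1 m) → Ψ x m ≤ g m := by
  have key : ∀ n, ∃ k : ℕ, ∀ x, (∀ i, (k : ℕ∞) ≤ (x i).1.1 n) → Ψ x n ≤ k := by
    intro n
    let j : (ι → T) → (ι → Inc) := fun x i => (x i).1
    -- `V k` is the largest open set on whose trace `Ψ · n ≤ k`. A point in no `W k` has all `n`-th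
    -- coordinates `⊤`, so it lies in the domain of `Ψ` and continuity puts it in some `V k`.
    let V : ℕ → Set (ι → Inc) := fun k =>
      ⋃₀ {U | IsOpen U ∧ ∀ x, j x ∈ U → Ψ x n ≤ k}
    let W : ℕ → Set (ι → Inc) := fun k => ⋃ i, {z | (z i).1 n < k}
    have hj : Topology.IsInducing j := Topology.IsInducing.piMap fun _ => .subtypeVal
    have hV : ∀ k, IsOpen (V k) := fun k => isOpen_sUnion fun U hU => hU.1
    have hW : ∀ k, IsOpen (W k) := fun k => isOpen_iUnion fun i =>
      isOpen_lt ((continuous_inc_apply n).comp (continuous_apply i)) continuous_const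
    have hmono : Monotone fun k => V k ∪ W k := by
      intro k l hkl
      refine union_subset_union ?_ ?_
      · exact sUnion_subset_sUnion fun U hU => ⟨hU.1, fun x hx => (hU.2 x hx).trans hkl⟩
      · exact iUnion_mono fun i z (hz : (z i).1 n < k) => hz.trans_le (Nat.cast_le.2 hkl)
    have hcov : univ ⊆ ⋃ k, V k ∪ W k := by
      intro z _
      by_cases hz : ∀ i, (z i).1 n = ⊤
      · let q : ι → T := fun i => ⟨z i, hT (mem_Q_of_apply_eq_top _ (hz i))⟩
        have hopen : IsOpen {x | Ψ x n = Ψ q n} :=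
          (isOpen_discrete {Ψ q n}).preimage ((continuous_apply n).comp hΨ)
        obtain ⟨U, hU, hUeq⟩ := hj.isOpen_iff.1 hopen
        refine mem_iUnion.2 ⟨Ψ q n, Or.inl ⟨U, ⟨hU, fun x hx => ?_⟩, ?_⟩⟩
        · have : x ∈ {x | Ψ x n = Ψ q n} := hUeq ▸ hx
          exact le_of_eq this
        · have : q ∈ j ⁻¹' U := by
            rw [hUeq]
            rfl
          exact this
      · push Not at hz
        obtain ⟨i, hi⟩ := hz
        refine mem_iUnion.2 ⟨((z i).1 n).toNat + 1, Or.inr (mem_iUnion.2 ⟨i, ?_⟩)⟩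
        change (z i).1 n < _
        conv_lhs => rw [← ENat.natCast_toNat hi]
        exact_mod_cast Nat.lt_succ_self _
    obtain ⟨k, hk⟩ := isCompact_univ.elim_directed_cover _ (fun k => (hV k).union (hW k)) hcov
      hmono.directed_le
    refine ⟨k, fun x hx => ?_⟩
    rcases hk (mem_univ (j x)) with ⟨U, hU, hxU⟩ | h
    · exact hU.2 x hxU
    · obtain ⟨i, hi⟩ := mem_iUnion.1 h
      exact absurd hi (not_lt.2 (hx i))
  choose g hg using key
  exact ⟨g, fun x m => hg m x⟩

/-! ### Boundedness with respect to families of sets -/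

/-- Membership in the family passes to sets that contain the given set up to finitely many
points. -/
def AlmostUpward (𝓖 : Set (Set ℕ)) : Prop :=
  ∀ A B : Set ℕ, A ∈ 𝓖 → (∀ᶠ n in atTop, n ∈ A → n ∈ B) → B ∈ 𝓖

theorem AlmostUpward.leMod_mono {𝓖 : Set (Set ℕ)} (h𝓖 : AlmostUpward 𝓖) {f g g' : ℕ → ℕ}
    (h : LeMod 𝓖 f g) (hg : ∀ᶠ n in atTop, g n ≤ g' n) : LeMod 𝓖 f g' :=
  h𝓖 _ _ h (hg.mono fun _ h h' => le_trans h' h)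

theorem mem_of_eventually {F : Filter ℕ} (hF : F ≤ cofinite) {A : Set ℕ}
    (h : ∀ᶠ n in atTop, n ∈ A) : A ∈ F :=
  hF (by rwa [Nat.cofinite_eq_atTop])

theorem almostUpward_positive {F : Filter ℕ} (hF : F ≤ cofinite) :
    AlmostUpward (positive F.sets) := by
  intro A B hA hAB hB
  refine hA ?_
  filter_upwards [hB, mem_of_eventually hF hAB] with n hn h hnA using hn (h hnA)

theorem almostUpward_atTop : AlmostUpward (atTop : Filter ℕ).sets := by
  intro A B hA hAB
  filter_upwards [hA, hAB] with n hn h using h hn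

theorem exists_eventually_bound {ι : Type*} [Countable ι] (G : ι → ℕ → ℕ) :
    ∃ g : ℕ → ℕ, ∀ i, ∀ᶠ n in atTop, G i n ≤ g n := by
  rcases isEmpty_or_nonempty ι with h | h
  · exact ⟨0, fun i => h.elim i⟩
  · obtain ⟨φ, hφ⟩ := exists_surjective_nat ι
    refine ⟨fun n => (Finset.range (n + 1)).sup fun i => G (φ i) n, fun i => ?_⟩
    obtain ⟨k, rfl⟩ := hφ i
    filter_upwards [eventually_ge_atTop k] with n hn
    exact Finset.le_sup (f := fun i => G (φ i) n) (Finset.mem_range.2 (Nat.lt_succ_of_le hn))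

theorem AlmostUpward.boundedMod_of_countable_cover {𝓖 : Set (Set ℕ)} (h𝓖 : AlmostUpward 𝓖)
    {Y : Type*} {Ψ : Y → ℕ → ℕ} {ι : Type*} [Countable ι]
    (A : ι → Set Y) (hA : ∀ y, ∃ i, y ∈ A i) (hb : ∀ i, BoundedMod 𝓖 (Ψ '' A i)) :
    BoundedMod 𝓖 (range Ψ) := by
  choose G hG using hb
  obtain ⟨g, hg⟩ := exists_eventually_bound G
  refine ⟨g, ?_⟩
  rintro _ ⟨y, rfl⟩
  obtain ⟨i, hi⟩ := hA y
  exact h𝓖.leMod_mono (hG i _ (mem_image_of_mem _ hi)) (hg i)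

/-- Finite powers of a space satisfy `Bdd(𝓖)` if every continuous map on a power is bounded on the
points with all coordinates outside of some small set, and small sets of bounds are bounded. -/
theorem AlmostUpward.bdd_pow {𝓖 : Set (Set ℕ)} (h𝓖 : AlmostUpward 𝓖)
    {Y : Type*} [TopologicalSpace Y] (small : Set Y → Prop)
    (hsmall : ∀ Z, small Z → ∀ G : Y → ℕ → ℕ,
      ∃ g', ∀ z ∈ Z, ∀ ψ, LeMod 𝓖 ψ (G z) → LeMod 𝓖 ψ g')
    (htail : ∀ (n : ℕ) (Ψ : (Fin n → Y) → ℕ → ℕ), Continuous Ψ →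
      ∃ Z, small Z ∧ ∃ g, ∀ x, (∀ i, x i ∉ Z) → LeMod 𝓖 (Ψ x) g) (n : ℕ) :
    Bdd 𝓖 (Fin n → Y) := by
  induction n with
  | zero =>
    intro Ψ hΨ
    obtain ⟨Z, -, g, hg⟩ := htail 0 Ψ hΨ
    refine ⟨g, ?_⟩
    rintro _ ⟨x, rfl⟩
    exact hg x fun i => i.elim0
  | succ n ih =>
    intro Ψ hΨ
    obtain ⟨Z, hZ, g, hg⟩ := htail (n + 1) Ψ hΨ
    -- Freezing coordinate `i` at `z` leaves a map on the `n`-th power.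
    have h1 : ∀ (i : Fin (n + 1)) (z : Y), ∃ g', ∀ y : Fin n → Y,
        LeMod 𝓖 (Ψ (i.insertNth z y)) g' := by
      intro i z
      obtain ⟨g', hg'⟩ := ih (fun y => Ψ (i.insertNth z y))
        (hΨ.comp (continuous_const.finInsertNth i continuous_id))
      exact ⟨g', fun y => hg' _ ⟨y, rfl⟩⟩
    choose G hG using h1
    have h2 := fun i => hsmall Z hZ (G i)
    choose g' hg' using h2
    refine h𝓖.boundedMod_of_countable_cover (ι := Option (Fin (n + 1)))
      (fun o => o.elim {x | ∀ i, x i ∉ Z} fun i => {x | x i ∈ Z}) (fun x => ?_) ?_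
    · by_cases h : ∀ i, x i ∉ Z
      · exact ⟨none, h⟩
      · push Not at h
        obtain ⟨i, hi⟩ := h
        exact ⟨some i, hi⟩
    · rintro (_ | i)
      · refine ⟨g, ?_⟩
        rintro _ ⟨x, hx, rfl⟩
        exact hg x hx
      · refine ⟨g' i, ?_⟩
        rintro _ ⟨x, hx, rfl⟩
        refine hg' i (x i) hx _ ?_
        have := hG i (x i) (i.removeNth x)
        rwa [Fin.insertNth_self_removeNth] at this

/-! ### Scales -/

theorem boundedMod_of_card_lt {𝓕 : Set (Set ℕ)} {Y : Set (ℕ → ℕ)}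
    (h : Cardinal.mk Y < bNum 𝓕) : BoundedMod 𝓕 Y := by
  by_contra hY
  exact notMem_of_lt_csInf' h ⟨Y, hY, rfl⟩

/-- The points of a set `S ∪ Q` at which an element of a scale is not a lower bound modulo the
filter are few. -/
theorem IsScale.exists_small {F : Filter ℕ} (hF : F ≤ cofinite) {S : Set (ℕ → ℕ)}
    (hS : IsScale F.sets S) {u : ℕ → ℕ} (hu : u ∈ S) :
    ∃ Z : Set ↑(toInc S ∪ Q), Cardinal.mk Z < bNum F.sets ∧
      ∀ t ∉ Z, {m | (u m : ℕ∞) ≤ t.1.1 m} ∈ F := by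
  obtain ⟨-, -, f, hSf, hf⟩ := hS
  have hu' := hu
  rw [hSf] at hu'
  obtain ⟨α, hα, rfl⟩ := hu'
  -- The exceptions have index below that of `u`. Points of `Q` are never needed as exceptions,
  -- being eventually `⊤`.
  refine ⟨{t | ∃ β < α, t.1.1 = fun n => (f β n : ℕ∞)}, ?_, ?_⟩
  · refine lt_of_le_of_lt ?_ (Cardinal.lt_ord.1 hα)
    have hinj : ∀ t : {t : ↑(toInc S ∪ Q) | ∃ β < α, t.1.1 = fun n => (f β n : ℕ∞)},
        ∃ β : Iio α, t.1.1.1 = fun n => (f β n : ℕ∞) :=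
      fun ⟨t, β, hβ, h⟩ => ⟨⟨β, hβ⟩, h⟩
    choose φ hφ using hinj
    have hφi : Function.Injective φ := by
      intro s t h
      apply Subtype.ext
      apply Subtype.ext
      apply Subtype.ext
      rw [hφ s, hφ t, h]
    have := Cardinal.mk_le_of_injective (hφi.comp Equiv.ulift.{1}.injective)
    rw [Cardinal.mk_uLift, Cardinal.mk_Iio_ordinal, Cardinal.lift_le] at this
    exact this
  · intro t ht
    rcases t.2 with ⟨g, hg, hgt⟩ | hQ
    · rw [hSf] at hg
      obtain ⟨β, hβ, rfl⟩ := hg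
      have hαβ : α ≤ β := by
        by_contra h
        exact ht ⟨β, not_le.1 h, hgt⟩
      rcases hαβ.eq_or_lt with rfl | h
      · rw [hgt]
        simp
      · rw [hgt]
        simpa [LeMod] using hf α β h hβ
    · refine mem_of_eventually hF ((eventually_eq_top_of_mem_Q hQ).mono fun m hm => ?_)
      simp [hm]

theorem exists_mem_not_leMod {𝓕 : Set (Set ℕ)} {S : Set (ℕ → ℕ)} (h : ¬ BoundedMod 𝓕 S)
    (g : ℕ → ℕ) : ∃ u ∈ S, ¬ LeMod 𝓕 u g := by
  by_contra! hc
  exact h ⟨g, hc⟩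

/-- The set where `g < u` is `F`-positive, so it stays positive when cut with the `F`-many places at
which all coordinates are at least `u`; there `Ψ x ≤ g`. -/
theorem IsScale.bdd_positive_pow {F : Filter ℕ} (hF : F ≤ cofinite) {S : Set (ℕ → ℕ)}
    (hS : IsScale F.sets S) (n : ℕ) :
    Bdd (positive F.sets) (Fin n → ↑(toInc S ∪ Q)) := by
  refine (almostUpward_positive hF).bdd_pow (fun Z => Cardinal.mk Z < bNum F.sets) ?_ ?_ n
  · intro Z hZ G
    obtain ⟨g', hg'⟩ := boundedMod_of_card_lt (Y := G '' Z)
      (Cardinal.mk_image_le.trans_lt hZ)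
    refine ⟨g', fun z hz ψ hψ hc => hψ ?_⟩
    filter_upwards [hc, hg' _ (mem_image_of_mem G hz)] with m hm (h : G z m ≤ g' m) (h' : ψ m ≤ G z m)
    exact hm (h'.trans h)
  · intro n Ψ hΨ
    obtain ⟨g, hg⟩ := exists_bound_of_large subset_union_right hΨ
    obtain ⟨u, hu, hug⟩ := exists_mem_not_leMod hS.2.1 g
    obtain ⟨Z, hZ, hZu⟩ := hS.exists_small hF hu
    refine ⟨Z, hZ, g, fun x hx hc => hug ?_⟩
    have hall : ∀ᶠ m in F, ∀ i, (u m : ℕ∞) ≤ (x i).1.1 m :=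
      eventually_all.2 fun i => hZu _ (hx i)
    change ∀ᶠ m in F, u m ≤ g m
    filter_upwards [hall, hc] with m hm hcm
    by_contra hlt
    refine hcm (hg x m fun i => le_trans ?_ (hm i))
    exact_mod_cast (not_le.1 hlt).le

/-- An inequality holding on a member of `F` holds somewhere in almost every interval `[h j, h (j +
1))`; for monotone functions this gives information at the endpoints of almost all intervals. -/
theorem IsScale.bdd_atTop_pow_of_feeble {F : Filter ℕ} (hF : F ≤ cofinite) {S : Set (ℕ → ℕ)}
    (hS : IsScale F.sets S) (hfeeble : Feeble F.sets) (n : ℕ) :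
    Bdd (atTop : Filter ℕ).sets (Fin n → ↑(toInc S ∪ Q)) := by
  obtain ⟨h, hmono, hh⟩ := hfeeble
  refine almostUpward_atTop.bdd_pow (fun Z => Cardinal.mk Z < bNum F.sets) ?_ ?_ n
  · intro Z hZ G
    -- With running maxima, a bound at any `m ≥ h j ≥ j` also bounds `G z j`.
    let G' : ↑(toInc S ∪ Q) → ℕ → ℕ := fun z m => (Finset.range (m + 1)).sup (G z)
    obtain ⟨v, hv⟩ := boundedMod_of_card_lt (Y := G' '' Z)
      (Cardinal.mk_image_le.trans_lt hZ)
    refine ⟨fun j => (Finset.range (h (j + 1))).sup v, fun z hz ψ hψ => ?_⟩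
    change ∀ᶠ j in atTop, _
    filter_upwards [hψ, hh _ (hv _ (mem_image_of_mem G' hz))] with j (hj : ψ j ≤ G z j) hne
    obtain ⟨m, hm, hm1, hm2⟩ := hne
    calc ψ j ≤ G z j := hj
      _ ≤ G' z m := Finset.le_sup (f := G z)
          (Finset.mem_range.2 (Nat.lt_succ_of_le ((hmono.id_le j).trans hm1)))
      _ ≤ v m := hm
      _ ≤ _ := Finset.le_sup (Finset.mem_range.2 hm2)
  · intro n Ψ hΨ
    let Ψ' : (Fin n → ↑(toInc S ∪ Q)) → ℕ → ℕ := fun x m => (Finset.range (m + 1)).sup (Ψ x)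
    have hΨ' : Continuous Ψ' := continuous_pi fun m =>
      Continuous.finset_sup_apply fun j _ => (continuous_apply j).comp hΨ
    obtain ⟨g, hg⟩ := exists_bound_of_large subset_union_right hΨ'
    -- Infinitely often `u` exceeds `g` taken at the right endpoint of the interval. A coordinate
    -- above `u` somewhere in that interval is then large at this endpoint.
    obtain ⟨u, hu, hug⟩ := exists_mem_not_leMod hS.2.1 fun m => g (h (m + 1))
    obtain ⟨Z, hZ, hZu⟩ := hS.exists_small hF hu
    have hinf : ∀ j, ∃ m ≥ j, g (h (m + 1)) < u m := by
      intro j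
      by_contra! hc
      exact hug (mem_of_eventually hF ((eventually_ge_atTop j).mono hc))
    choose N hN hNu using hinf
    refine ⟨Z, hZ, fun j => g (h (N j + 1)), fun x hx => ?_⟩
    have hall : ∀ᶠ m in atTop, ∀ i, ({m | (u m : ℕ∞) ≤ (x i).1.1 m} ∩
        Ico (h m) (h (m + 1))).Nonempty := eventually_all.2 fun i => hh _ (hZu _ (hx i))
    obtain ⟨M, hM⟩ := eventually_atTop.1 hall
    refine eventually_atTop.2 ⟨M, fun j hj => ?_⟩
    refine le_trans (Finset.le_sup (f := Ψ x) (Finset.mem_range.2 ?_))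
      (hg x (h (N j + 1)) fun i => ?_)
    · have := hmono.id_le (N j + 1)
      have := hN j
      simp only [id_eq] at *
      omega
    · obtain ⟨m, hm, hm1, hm2⟩ := hM (N j) (hj.trans (hN j)) i
      calc ((g (h (N j + 1)) : ℕ) : ℕ∞) ≤ (u (N j) : ℕ∞) := by exact_mod_cast (hNu j).le
        _ ≤ (u m : ℕ∞) := by
          exact_mod_cast (hS.1 u hu).monotone ((hmono.id_le (N j)).trans hm1)
        _ ≤ (x i).1.1 m := hm
        _ ≤ (x i).1.1 (h (N j + 1)) := (x i).1.2.1 hm2.le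

/-! ### Fields generated by algebraically independent sets -/

theorem countable_mvPolynomial (n : ℕ) : Countable (MvPolynomial (Fin n) ℚ) := by
  rw [← Cardinal.mk_le_aleph0_iff]
  refine MvPolynomial.cardinalMk_le_max.trans ?_
  simp

theorem AlgebraicIndependent.aeval_comp_ne_zero {Y A : Type*} [CommRing A] [Algebra ℚ A]
    {a : Y → A} (ha : AlgebraicIndependent ℚ a) {n : ℕ} {x : Fin n → Y}
    (hx : Function.Injective x) {s : MvPolynomial (Fin n) ℚ} (hs : s ≠ 0) :
    MvPolynomial.aeval (fun i => a (x i)) s ≠ 0 := fun h =>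
  hs ((algebraicIndependent_iff.1 (ha.comp x hx)) s h)

/-- Finitely many elements of a field generated by a family are values of rational functions at a
common tuple of distinct members of the family. -/
theorem exists_common_ratio {Y : Type*} {a : Y → ℝ} {k : ℕ}
    (y : Fin k → IntermediateField.adjoin ℚ (range a)) :
    ∃ (n : ℕ) (x : Fin n → Y) (r s : Fin k → MvPolynomial (Fin n) ℚ),
      Function.Injective x ∧ (∀ j, s j ≠ 0) ∧
      ∀ j, (y j : ℝ) = MvPolynomial.aeval (fun i => a (x i)) (r j) /
        MvPolynomial.aeval (fun i => a (x i)) (s j) := by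
  classical
  have h : ∀ j, ∃ r s : MvPolynomial Y ℚ, s ≠ 0 ∧
      (y j : ℝ) = MvPolynomial.aeval a r / MvPolynomial.aeval a s := by
    intro j
    obtain ⟨r, s, h⟩ := (IntermediateField.mem_adjoin_range_iff ℚ a _).1 (y j).2
    -- A zero denominator gives the value `0` by convention, rewritten as `0 / 1`.
    by_cases hs : s = 0
    · exact ⟨0, 1, one_ne_zero, by simp [h, hs]⟩
    · exact ⟨r, s, hs, h⟩
  choose r s hs hy using h
  let V : Finset Y := Finset.univ.biUnion fun j => (r j).vars ∪ (s j).vars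
  let x : Fin V.card → Y := fun i => (V.equivFin.symm i : Y)
  have hx : Function.Injective x := Subtype.val_injective.comp V.equivFin.symm.injective
  have hV : ∀ v ∈ V, v ∈ range x := fun v hv => ⟨V.equivFin ⟨v, hv⟩, by simp [x]⟩
  have hr : ∀ j, ∃ q, MvPolynomial.rename x q = r j := fun j =>
    MvPolynomial.exists_rename_eq_of_vars_subset_range _ x hx fun v hv => hV v
      (Finset.mem_biUnion.2 ⟨j, Finset.mem_univ j, Finset.mem_union_left _ hv⟩)
  have hs' : ∀ j, ∃ q, MvPolynomial.rename x q = s j := fun j =>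
    MvPolynomial.exists_rename_eq_of_vars_subset_range _ x hx fun v hv => hV v
      (Finset.mem_biUnion.2 ⟨j, Finset.mem_univ j, Finset.mem_union_right _ hv⟩)
  choose r' hr' using hr
  choose s' hs' using hs'
  refine ⟨V.card, x, r', s', hx, fun j h => hs j ?_, fun j => ?_⟩
  · rw [← hs', h, map_zero]
  · rw [hy, ← hr', ← hs', MvPolynomial.aeval_rename, MvPolynomial.aeval_rename]
    rfl

/-- The tuple of values, in a field of reals, of rational functions at a tuple of members of a
family. -/
noncomputable def evalRatio {Y : Type*} {L : IntermediateField ℚ ℝ} (a : Y → L) {n k : ℕ}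
    (r s : Fin k → MvPolynomial (Fin n) ℚ) (x : Fin n → Y) (j : Fin k) : L :=
  MvPolynomial.aeval (fun i => a (x i)) (r j) / MvPolynomial.aeval (fun i => a (x i)) (s j)

theorem coe_evalRatio {Y : Type*} {L : IntermediateField ℚ ℝ} (a : Y → L) {n k : ℕ}
    (r s : Fin k → MvPolynomial (Fin n) ℚ) (x : Fin n → Y) (j : Fin k) :
    (evalRatio a r s x j : ℝ) = MvPolynomial.aeval (fun i => (a (x i) : ℝ)) (r j) /
      MvPolynomial.aeval (fun i => (a (x i) : ℝ)) (s j) := by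
  have h : ∀ p : MvPolynomial (Fin n) ℚ, L.val (MvPolynomial.aeval (fun i => a (x i)) p) =
      MvPolynomial.aeval (fun i => (a (x i) : ℝ)) p := fun p =>
    MvPolynomial.comp_aeval_apply _ _ _
  rw [← h, ← h, ← map_div₀]
  rfl

theorem continuousOn_evalRatio {Y : Type*} [TopologicalSpace Y] {L : IntermediateField ℚ ℝ}
    {a : Y → L} (ha : Continuous a) (hai : AlgebraicIndependent ℚ fun y => (a y : ℝ)) {n k : ℕ}
    (r : Fin k → MvPolynomial (Fin n) ℚ) {s : Fin k → MvPolynomial (Fin n) ℚ}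
    (hs : ∀ j, s j ≠ 0) : ContinuousOn (evalRatio a r s) {x | Function.Injective x} := by
  refine continuousOn_pi.2 fun j => ?_
  rw [Topology.IsInducing.subtypeVal.continuousOn_iff]
  have hpoly : ∀ p : MvPolynomial (Fin n) ℚ,
      Continuous fun x : Fin n → Y => MvPolynomial.aeval (fun i => (a (x i) : ℝ)) p := fun p => by
    simp only [MvPolynomial.aeval_def, MvPolynomial.eval₂_eq_eval_map]
    exact (MvPolynomial.continuous_eval _).comp (continuous_pi fun i =>
      continuous_subtype_val.comp (ha.comp (continuous_apply i)))
  refine ((hpoly (r j)).continuousOn.div (hpoly (s j)).continuousOn fun x hx =>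
    AlgebraicIndependent.aeval_comp_ne_zero hai hx (hs j)).congr fun x _ => ?_
  exact coe_evalRatio a r s x j

/-- `Bdd(𝓖)` passes from the finite powers of a space `Y` to the finite powers of the field
generated by an algebraically independent continuous image of `Y`. -/
theorem AlmostUpward.bdd_adjoin_pow {𝓖 : Set (Set ℕ)} (h𝓖 : AlmostUpward 𝓖)
    {Y : Type*} [TopologicalSpace Y] (hY : ∀ n : ℕ, Bdd 𝓖 (Fin n → Y))
    {κ : Type*} [Countable κ] [Nonempty κ] (D : κ → Set Y) (hD : ∀ i, IsClopen (D i))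
    (hsep : ∀ x y, x ≠ y → ∃ i, x ∈ D i ↔ y ∉ D i)
    {a : Y → ℝ} (ha : Continuous a) (hai : AlgebraicIndependent ℚ a) (k : ℕ) :
    Bdd 𝓖 (Fin k → IntermediateField.adjoin ℚ (range a)) := by
  classical
  intro Ψ hΨ
  have := countable_mvPolynomial
  let a' : Y → IntermediateField.adjoin ℚ (range a) := fun y =>
    ⟨a y, IntermediateField.subset_adjoin ℚ _ (mem_range_self y)⟩
  have ha' : Continuous a' := ha.subtype_mk _
  -- `σ` names a clopen set separating each pair of coordinates, so these countably many clopen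
  -- pieces cover exactly the injective tuples.
  let E : ∀ n : ℕ, (Fin n → Fin n → κ) → Set (Fin n → Y) := fun n σ =>
    ⋂ i, ⋂ j, {x | i ≠ j → (x i ∈ D (σ i j) ↔ x j ∉ D (σ i j))}
  have hE : ∀ n σ, IsClopen (E n σ) := by
    intro n σ
    refine isClopen_iInter_of_finite fun i => isClopen_iInter_of_finite fun j => ?_
    by_cases hij : i = j
    · simpa [hij] using isClopen_univ
    · have h1 := (hD (σ i j)).preimage (continuous_apply (A := fun _ => Y) i)
      have h2 := (hD (σ i j)).preimage (continuous_apply (A := fun _ => Y) j)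
      convert (h1.inter h2.compl).union (h1.compl.inter h2) using 1
      ext x
      simp only [mem_ofPred_eq, mem_union, mem_inter_iff, mem_preimage, mem_compl_iff]
      tauto
  have hEinj : ∀ n σ, ∀ x ∈ E n σ, Function.Injective x := by
    intro n σ x hx i j hij
    by_contra hne
    have := mem_iInter.1 (mem_iInter.1 hx i) j hne
    rw [hij] at this
    tauto
  refine h𝓖.boundedMod_of_countable_cover
    (ι := Σ n : ℕ, (Fin k → MvPolynomial (Fin n) ℚ) ×
      (Fin k → {s : MvPolynomial (Fin n) ℚ // s ≠ 0}) × (Fin n → Fin n → κ))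
    (fun c => evalRatio a' c.2.1 (fun j => (c.2.2.1 j).1) '' E c.1 c.2.2.2) (fun y => ?_) ?_
  · obtain ⟨n, x, r, s, hx, hs, hy⟩ := exists_common_ratio y
    have hσ : ∀ i j, ∃ c, i ≠ j → (x i ∈ D c ↔ x j ∉ D c) := by
      intro i j
      by_cases hij : i = j
      · exact ⟨Classical.arbitrary κ, fun h => absurd hij h⟩
      · exact (hsep _ _ (hx.ne hij)).imp fun c hc _ => hc
    choose σ hσ using hσ
    refine ⟨⟨n, r, fun j => ⟨s j, hs j⟩, σ⟩, x, mem_iInter₂.2 hσ, ?_⟩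
    funext j
    exact Subtype.ext ((coe_evalRatio a' r s x j).trans (hy j).symm)
  · rintro ⟨n, r, s, σ⟩
    have hcont : ContinuousOn (evalRatio a' r fun j => (s j).1) (E n σ) :=
      (continuousOn_evalRatio ha' hai r fun j => (s j).2).mono (hEinj n σ)
    -- Since the piece is clopen, extension by `0` is continuous on the whole power.
    have hΨ' : Continuous ((E n σ).piecewise (Ψ ∘ evalRatio a' r fun j => (s j).1) fun _ => 0) := by
      refine continuous_piecewise ?_ ?_ continuousOn_const
      · simp [(hE n σ).frontier_eq]
      · rw [(hE n σ).1.closure_eq]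
        exact hΨ.comp_continuousOn hcont
    obtain ⟨g, hg⟩ := hY n _ hΨ'
    refine ⟨g, ?_⟩
    rintro _ ⟨_, ⟨x, hx, rfl⟩, rfl⟩
    have := hg _ ⟨x, rfl⟩
    rwa [piecewise_eq_of_mem _ _ _ hx] at this

/-- A point of `C` outside `X` is transcendental over `ℚ[X]`, whereas a quotient `p / q` is a root
of `q T - p`. -/
theorem mem_of_mem_adjoin {C X : Set ℝ} (hC : AlgebraicIndependent ℚ (Subtype.val : C → ℝ))
    (hXC : X ⊆ C) {c : ℝ} (hc : c ∈ C) (hcX : c ∈ IntermediateField.adjoin ℚ X) : c ∈ X := by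
  by_contra hn
  have htr := hC.transcendental_adjoin (s := Subtype.val ⁻¹' X) (i := ⟨c, hc⟩) hn
  rw [Subtype.image_preimage_coe, inter_eq_right.2 hXC] at htr
  obtain ⟨p, hp, q, hq, hpq⟩ := (IntermediateField.mem_adjoin_iff_div).1 hcX
  have hq0 : q ≠ 0 := by
    rintro rfl
    refine htr ?_
    simp only [hpq, div_zero]
    exact isAlgebraic_zero
  refine htr ⟨Polynomial.C ⟨q, hq⟩ * Polynomial.X - Polynomial.C ⟨p, hp⟩, fun h => hq0 ?_, ?_⟩
  · have := congrArg (fun f => Polynomial.coeff f 1) h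
    simpa using congrArg Subtype.val (by simpa using this : (⟨q, hq⟩ : Algebra.adjoin ℚ X) = 0)
  · simp [hpq, Subalgebra.algebraMap_eq]
    field_simp
    simp

/-- A closed set of functions contained in a scale is countable. -/
theorem IsScale.countable_of_isClosed {F : Filter ℕ} (hF : F ≤ cofinite) {S : Set (ℕ → ℕ)}
    (hS : IsScale F.sets S) {A : Set (ℕ → ℕ)} (hA : IsClosed A) (hAS : A ⊆ S) : A.Countable := by
  by_contra hunc
  -- A Cantor set inside `A` is bounded everywhere by one `g`. Taking `u ≰_F g` forces it into a set
  -- of size below `𝔟(F) ≤ 2^ℵ₀`, which is absurd.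
  obtain ⟨φ, hφr, hφc, hφi⟩ := hA.exists_nat_bool_injection_of_not_countable hunc
  have hbd : ∀ n, ∃ m, ∀ x, φ x n ≤ m := fun n => by
    obtain ⟨m, hm⟩ := (isCompact_range ((continuous_apply n).comp hφc)).bddAbove
    exact ⟨m, fun x => hm ⟨x, rfl⟩⟩
  choose g hg using hbd
  obtain ⟨u, hu, hug⟩ := exists_mem_not_leMod hS.2.1 g
  obtain ⟨Z, hZ, hZu⟩ := hS.exists_small hF hu
  have hmemZ : ∀ x, (⟨incOf ⟨φ x, hS.1 _ (hAS (hφr ⟨x, rfl⟩))⟩,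
      Or.inl (incOf_mem_toInc.2 (hAS (hφr ⟨x, rfl⟩)))⟩ : ↑(toInc S ∪ Q)) ∈ Z := by
    intro x
    by_contra hx
    refine hug (mem_of_superset (hZu _ hx) fun m (hm : (u m : ℕ∞) ≤ (φ x m : ℕ∞)) => ?_)
    exact (Nat.cast_le.1 hm).trans (hg m x)
  have hle : Cardinal.mk (ℕ → Bool) ≤ Cardinal.mk Z := by
    refine Cardinal.mk_le_of_injective (f := fun x => ⟨_, hmemZ x⟩) fun x y hxy => hφi ?_
    have h := congrArg (fun z : Z => z.1.1.1) hxy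
    funext n
    exact Nat.cast_injective (R := ℕ∞) (congrFun h n)
  have hb : bNum F.sets ≤ Cardinal.mk S := csInf_le' ⟨S, hS.2.1, rfl⟩
  have hlt := (hle.trans_lt hZ).trans_le (hb.trans (Cardinal.mk_set_le S))
  simp at hlt

theorem IsScale.not_countable {F : Filter ℕ} (hF : F ≤ cofinite) {S : Set (ℕ → ℕ)}
    (hS : IsScale F.sets S) : ¬ S.Countable := fun h => by
  have := h.to_subtype
  obtain ⟨g, hg⟩ := exists_eventually_bound (fun f : S => f.1)
  exact hS.2.1 ⟨g, fun f hf => mem_of_eventually hF (hg ⟨f, hf⟩)⟩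

/-- Compact pieces pull back along `incOf` to closed sets of functions inside `S`; these are
countable and cover the uncountable `S`. -/
theorem IsScale.not_isSigmaCompact {F : Filter ℕ} (hF : F ≤ cofinite) {S : Set (ℕ → ℕ)}
    (hS : IsScale F.sets S) : ¬ IsSigmaCompact (toInc S ∪ Q) := by
  rintro ⟨K, hK, hKu⟩
  have hclosed : IsClosed {f : ℕ → ℕ | StrictMono f} := by
    simp only [StrictMono, ofPred_forall]
    refine isClosed_iInter fun i => isClosed_iInter fun j => isClosed_iInter fun _ => ?_
    exact (isClosed_discrete {p : ℕ × ℕ | p.1 < p.2}).preimage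
      ((continuous_apply i).prodMk (continuous_apply j) :
        Continuous fun f : ℕ → ℕ => (f i, f j))
  refine hS.not_countable hF ((countable_iUnion fun n => hS.countable_of_isClosed hF
    (hclosed.isClosedEmbedding_subtypeVal.isClosedMap _
      ((hK n).isClosed.preimage continuous_incOf)) ?_).mono fun f hf => ?_)
  · rintro _ ⟨f, hf, rfl⟩
    rcases hKu.subset (mem_iUnion_of_mem n hf) with h | h
    · exact incOf_mem_toInc.1 h
    · exact absurd h (incOf_notMem_Q f)
  · have : incOf ⟨f, hS.1 f hf⟩ ∈ ⋃ n, K n := hKu ▸ Or.inl (incOf_mem_toInc.2 hf)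
    obtain ⟨n, hn⟩ := mem_iUnion.1 this
    exact mem_iUnion.2 ⟨n, _, hn, rfl⟩

end ScaleField

theorem theorem6p1
    -- an algebraically independent set of reals, identified with the Cantor space `Inc`
    (C : Set ℝ) (hC : AlgebraicIndependent ℚ (Subtype.val : C → ℝ)) (e : Inc ≃ₜ C)
    -- a free filter on `ℕ`
    (F : Filter ℕ) [F.NeBot] (hF : F ≤ Filter.cofinite)
    (S : Set (ℕ → ℕ)) (hS : IsScale F.sets S)
    (X : Set ℝ) (hX : X = realCopy e (toInc S ∪ Q)) :
    (∀ k : ℕ, Bdd (positive F.sets) (Fin k → IntermediateField.adjoin ℚ X)) ∧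
    ((∃ U : Ultrafilter ℕ, F = (U : Filter ℕ)) →
      ∀ k : ℕ, Bdd F.sets (Fin k → IntermediateField.adjoin ℚ X)) ∧
    (Feeble F.sets →
      ∀ k : ℕ, Hurewicz (Fin k → IntermediateField.adjoin ℚ X)) ∧
    (∀ P : Set ℝ → Prop, ClosedHereditary P →
      ¬ P X → ¬ P (IntermediateField.adjoin ℚ X : Set ℝ)) ∧
    ¬ IsSigmaCompact (IntermediateField.adjoin ℚ X : Set ℝ) := by
  have hXr : X = Set.range fun t : ↑(toInc S ∪ Q) => (e t.1 : ℝ) := by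
    rw [hX, realCopy, Set.image_eq_range]
  have hcont : Continuous fun t : ↑(toInc S ∪ Q) => (e t.1 : ℝ) :=
    continuous_subtype_val.comp (e.continuous.comp continuous_subtype_val)
  have hindep : AlgebraicIndependent ℚ fun t : ↑(toInc S ∪ Q) => (e t.1 : ℝ) :=
    hC.comp (fun t : ↑(toInc S ∪ Q) => e t.1) (e.injective.comp Subtype.val_injective)
  have hfield : ∀ 𝓖 : Set (Set ℕ), AlmostUpward 𝓖 →
      (∀ n : ℕ, Bdd 𝓖 (Fin n → ↑(toInc S ∪ Q))) →
      ∀ k : ℕ, Bdd 𝓖 (Fin k → IntermediateField.adjoin ℚ X) := by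
    intro 𝓖 h𝓖 h
    rw [hXr]
    -- Thresholds at finite values are clopen, as `≤ m` means `< m + 1`, and the smaller of two
    -- distinct values is a finite threshold separating them.
    refine h𝓖.bdd_adjoin_pow h (κ := ℕ × ℕ) (fun c => {t | t.1.1 c.1 ≤ (c.2 : ℕ∞)}) (fun c => ?_)
      (fun x y hxy => ?_) hcont hindep
    · have hc : Continuous fun t : ↑(toInc S ∪ Q) => t.1.1 c.1 :=
        (continuous_inc_apply c.1).comp continuous_subtype_val
      refine ⟨isClosed_le hc continuous_const, ?_⟩
      have : {t : ↑(toInc S ∪ Q) | t.1.1 c.1 ≤ (c.2 : ℕ∞)} = {t | t.1.1 c.1 < ((c.2 + 1 : ℕ) : ℕ∞)} := by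
        ext t
        rw [Set.mem_ofPred_eq, Set.mem_ofPred_eq, Nat.cast_add, Nat.cast_one,
          ENat.lt_add_one_iff (ENat.natCast_ne_top _)]
      rw [this]
      exact isOpen_lt hc continuous_const
    · obtain ⟨n, hn⟩ := Function.ne_iff.1 fun h => hxy (Subtype.ext (Subtype.ext h))
      rcases lt_or_gt_of_ne hn with h | h
      · obtain ⟨m, hm⟩ := ENat.ne_top_iff_exists.1 h.ne_top
        refine ⟨(n, m), ?_⟩
        simp [← hm] at h ⊢
        exact h
      · obtain ⟨m, hm⟩ := ENat.ne_top_iff_exists.1 h.ne_top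
        refine ⟨(n, m), ?_⟩
        simp [← hm] at h ⊢
        exact h
  have hpos := hfield _ (almostUpward_positive hF) (hS.bdd_positive_pow hF)
  have hXC : X ⊆ C := by
    rw [hXr]
    rintro _ ⟨t, rfl⟩
    exact (e t.1).2
  have hCc : IsCompact C := by
    have := e.compactSpace
    exact isCompact_iff_compactSpace.2 this
  have hinter : (IntermediateField.adjoin ℚ X : Set ℝ) ∩ C = X :=
    Set.Subset.antisymm (fun c hc => mem_of_mem_adjoin hC hXC hc.2 hc.1)
      fun c hc => ⟨IntermediateField.subset_adjoin ℚ X hc, hXC hc⟩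
  refine ⟨hpos, ?_, fun hfe => ?_, fun P hP hPX hPK => hPX ?_, fun hσ => ?_⟩
  · rintro ⟨U, rfl⟩
    have : positive (U : Filter ℕ).sets = (U : Filter ℕ).sets := by
      ext A
      exact Ultrafilter.compl_notMem_iff
    rwa [this] at hpos
  · exact hfield _ almostUpward_atTop (hS.bdd_atTop_pow_of_feeble hF hfe)
  · rw [← hinter]
    exact hP _ C hCc.isClosed hPK
  · have hXσ : IsSigmaCompact X := by
      rw [← hinter]
      obtain ⟨K, hK, hKu⟩ := hσ
      exact ⟨fun n => K n ∩ C, fun n => (hK n).inter_right hCc.isClosed, by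
        rw [← Set.iUnion_inter, hKu]⟩
    refine hS.not_isSigmaCompact hF ?_
    have hemb : Topology.IsEmbedding fun x : Inc => (e x : ℝ) :=
      Topology.IsEmbedding.subtypeVal.comp e.isEmbedding
    rwa [hemb.isSigmaCompact_iff, ← realCopy, ← hX]
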